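/- A binary code of length $n$ is a linear subspace $C\subseteq\mathbb{F}_2^n$; it is *self-dual* if it equals its dual $C^\perp$ under the standard inner product, and *doubly even* if every codeword has Hamming weight divisible by $4$. A doubly even self-dual code of length $n$ is *extremal* if its minimum weight (the least weight of a nonzero codeword) equals $4\lfloor n/24\rfloor+4$. A $t$-$(v,k,\lambda)$ design is a set $X$ of $v$ points together with a set of $k$-element subsets of $X$, called blocks (no repeated blocks), such that every $t$-element subset of $X$ is contained in exactly $\lambda$ blocks; it is *self-orthogonal* if for any two distinct blocks $B,B'$ the number $|B\cap B'|$ has the same parity as $k$. **Theorem.** Let $(24m,k,\lambda)$ be one of $(72,24,1406405)$, $(72,32,238957796)$, $(96,36,28080500448)$, $(96,44,1167789832440)$, $(120,56,5156299310025435)$, $(144,68,21788133027489299328)$. Then a self-orthogonal $5$-$(24m,k,\lambda)$ design exists if and only if an extremal doubly even self-dual code of length $24m$ exists. -/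

import Mathlib

/-- A (simple) `t`-`(v,k,lam)` design: a finite point set `X` with `v` points and a set `B` of
`k`-element subsets of `X` (the blocks), such that every `t`-element subset of `X` is contained in
exactly `lam` blocks. -/
structure IsDesign {X : Type*} [Fintype X] [DecidableEq X] (t v k lam : ℕ)
    (B : Finset (Finset X)) : Prop where
  card_points : Fintype.card X = v
  card_block : ∀ b ∈ B, b.card = k
  balanced : ∀ T : Finset X, T.card = t → (B.filter (fun b => T ⊆ b)).card = lam

/-- A design is self-orthogonal if any two distinct blocks meet in a number of points which has
the same parity as the block size `k`. -/
structure IsSelfOrthogonalDesign {X : Type*} [Fintype X] [DecidableEq X] (t v k lam : ℕ)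
    (B : Finset (Finset X)) : Prop extends IsDesign t v k lam B where
  inter_parity : ∀ b₁ ∈ B, ∀ b₂ ∈ B, b₁ ≠ b₂ → (b₁ ∩ b₂).card ≡ k [MOD 2]

/-- A binary (linear) code of length `n` is a subspace of `𝔽₂ⁿ`. -/
abbrev BinaryCode (n : ℕ) := Submodule (ZMod 2) (Fin n → ZMod 2)

namespace BinaryCode

/-- The dual code under the standard inner product. -/
def dual {n : ℕ} (C : BinaryCode n) : BinaryCode n where
  carrier := {x | ∀ c ∈ C, x ⬝ᵥ c = 0}
  zero_mem' := fun c _ => zero_dotProduct c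
  add_mem' := fun {x y} hx hy c hc => by rw [add_dotProduct, hx c hc, hy c hc, add_zero]
  smul_mem' := fun a x hx c hc => by rw [smul_dotProduct, hx c hc, smul_zero]

/-- A code is self-dual if it equals its dual. -/
def IsSelfDual {n : ℕ} (C : BinaryCode n) : Prop := C = dual C

/-- A code is doubly even if every codeword has (Hamming) weight divisible by `4`. -/
def IsDoublyEven {n : ℕ} (C : BinaryCode n) : Prop := ∀ c ∈ C, 4 ∣ hammingNorm c

/-- `C` has minimum weight `d`: `d` is the smallest weight of a nonzero codeword. -/
def HasMinWeight {n : ℕ} (C : BinaryCode n) (d : ℕ) : Prop :=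
  IsLeast {w : ℕ | ∃ c ∈ C, c ≠ 0 ∧ hammingNorm c = w} d

/-- An extremal doubly even self-dual code of length `n`: a doubly even self-dual code with minimum
weight `4⌊n/24⌋ + 4`. -/
structure IsExtremalDoublyEvenSelfDual {n : ℕ} (C : BinaryCode n) : Prop where
  doublyEven : IsDoublyEven C
  selfDual : IsSelfDual C
  minWeight : HasMinWeight C (4 * (n / 24) + 4)

end BinaryCode

/-
Words of `𝔽₂ⁿ` are identified with their supports, so that a doubly even self-dual code is a family
`W` of sets of sizes divisible by `4` which equals its own dual for the parity of intersections.

The main tool is Poisson summation over a code, that is, the MacWilliams identities. For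
`v ↦ P #v`, where the degree of the polynomial `P` is less than all nonzero weights, only the zero
word contributes on one side. If moreover `P` vanishes at all weights but one and the length, this
counts the words of that weight containing a given `5`-set (Assmus–Mattson). It shows that the words
of weight `k` of an extremal code form a design, with the given `λ`.

Conversely, a maximal doubly even self-orthogonal family `W` containing the blocks of a design is
self-dual, by evaluating the Gauss sum `∑ i ^ #v` over its dual. Since all members of `W` meet the
blocks evenly, the intersection equations of the design exclude the weights `4` and `8`. Consider
for each word the difference of its contributions to the two sides of the Poisson formula, for the
polynomial `P` whose zeros are the weights of an extremal code other than `k`. These defects add up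
to zero over the empty set, the set of all points and the blocks. They are nonnegative for all other
words of weight at least `12`, and would be positive for a weight at most `4 * m`. So no such weight
occurs, and the weight `4 * m + 4` does occur by the count above.
-/

open Finset Polynomial
open scoped symmDiff

section EvenDual

variable {α : Type*} [DecidableEq α]

theorem card_symmDiff_add_two_mul_card_inter (a b : Finset α) :
    #(a ∆ b) + 2 * #(a ∩ b) = #a + #b := by
  have hdisj : #(a ∆ b) = #(a \ b) + #(b \ a) := card_union_of_disjoint disjoint_sdiff_sdiff
  have ha := card_sdiff_add_card_inter a b
  have hb := card_sdiff_add_card_inter b a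
  rw [inter_comm b a] at hb
  lia

theorem four_dvd_card_symmDiff {a b : Finset α} (ha : 4 ∣ #a) (hb : 4 ∣ #b)
    (hab : Even #(a ∩ b)) : 4 ∣ #(a ∆ b) := by
  have := card_symmDiff_add_two_mul_card_inter a b
  grind

theorem neg_one_pow_card_inter_symmDiff {R : Type*} [Ring R] (s a b : Finset α) :
    (-1 : R) ^ #(s ∩ (a ∆ b)) = (-1) ^ #(s ∩ a) * (-1) ^ #(s ∩ b) := by
  have hdistrib : s ∩ (a ∆ b) = (s ∩ a) ∆ (s ∩ b) := inf_symmDiff_distrib_left s a b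
  rw [hdistrib, ← pow_add, ← card_symmDiff_add_two_mul_card_inter, pow_add, pow_mul, neg_one_sq,
    one_pow, mul_one]

theorem even_card_symmDiff_inter {a b s : Finset α} (ha : Even #(a ∩ s)) (hb : Even #(b ∩ s)) :
    Even #((a ∆ b) ∩ s) := by
  have hdistrib : (a ∆ b) ∩ s = (a ∩ s) ∆ (b ∩ s) := inf_symmDiff_distrib_right a b s
  have hcard := card_symmDiff_add_two_mul_card_inter (a ∩ s) (b ∩ s)
  rw [hdistrib]
  grind

/-- A family of sets which, identified with its family of indicator vectors, is a binary linear
code. -/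
structure IsLinearFamily (W : Finset (Finset α)) : Prop where
  empty_mem : ∅ ∈ W
  symmDiff_mem : ∀ a ∈ W, ∀ b ∈ W, a ∆ b ∈ W

variable [Fintype α]

/-- The dual of a family of sets, for the pairing of sets by the parity of their intersection. This
is the dual code in terms of supports of codewords. -/
def evenDual (W : Finset (Finset α)) : Finset (Finset α) := {v | ∀ c ∈ W, Even #(v ∩ c)}

variable {W : Finset (Finset α)}

theorem mem_evenDual {v : Finset α} : v ∈ evenDual W ↔ ∀ c ∈ W, Even #(v ∩ c) := by
  simp [evenDual]

theorem isLinearFamily_evenDual (W : Finset (Finset α)) : IsLinearFamily (evenDual W) where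
  empty_mem := mem_evenDual.2 fun c _ => by simp
  symmDiff_mem _ ha _ hb := mem_evenDual.2 fun c hc =>
    even_card_symmDiff_inter (mem_evenDual.1 ha c hc) (mem_evenDual.1 hb c hc)

namespace IsLinearFamily

variable {R : Type*} [CommRing R]

theorem sum_neg_one_pow_card_inter (hW : IsLinearFamily W) (v : Finset α) :
    ∑ c ∈ W, (-1 : R) ^ #(v ∩ c) = if v ∈ evenDual W then (#W : R) else 0 := by
  split_ifs with hv
  · rw [sum_congr rfl fun c hc => (mem_evenDual.1 hv c hc).neg_one_pow, sum_const, nsmul_one]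
  · obtain ⟨d, hd, hodd⟩ : ∃ d ∈ W, Odd #(v ∩ d) := by simpa [mem_evenDual] using hv
    have hd_ne : d ≠ ⊥ := by rintro rfl; simp at hodd
    -- Translation by `d` reverses all signs.
    refine sum_involution (fun c _ => c ∆ d) (fun c _ => ?_) (fun c _ _ => ?_)
      (fun c hc => hW.symmDiff_mem c hc d hd) (fun c _ => symmDiff_symmDiff_cancel_right d c)
    · rw [neg_one_pow_card_inter_symmDiff, hodd.neg_one_pow, mul_neg_one, add_neg_cancel]
    · rwa [Ne, symmDiff_eq_left]

theorem sum_sum_neg_one_pow_mul (hW : IsLinearFamily W) (F : Finset α → R) :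
    ∑ x ∈ W, ∑ S, (-1) ^ #(S ∩ x) * F S = #W * ∑ v ∈ evenDual W, F v := by
  rw [sum_comm, mul_sum]
  simp only [← sum_mul, hW.sum_neg_one_pow_card_inter, ite_mul, zero_mul, sum_ite_mem, univ_inter]

end IsLinearFamily

end EvenDual

section KrawtchoukTransform

variable {R : Type*} [CommRing R]

/-- The value at a set of size `w` of the Fourier transform of `S ↦ f #S` on the subsets of a set
with `w + u` points: the sum of `(-1) ^ #(S ∩ x) * f #S` over all `S`, where `#x = w`. -/
def krawtchoukTransform (f : ℕ → R) (w u : ℕ) : R :=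
  ∑ a ∈ range (w + 1), ∑ b ∈ range (u + 1), (-1) ^ a * (w.choose a * u.choose b) * f (a + b)

/-- Each value of `f` occurs only once on the right, which makes evaluations feasible. -/
theorem krawtchoukTransform_eq_sum_range (f : ℕ → R) (w u : ℕ) :
    krawtchoukTransform f w u = ∑ j ∈ range (w + u + 1),
      (∑ a ∈ range (w + 1) with a ≤ j, (-1 : R) ^ a * (w.choose a * u.choose (j - a))) * f j := by
  simp only [sum_mul, sum_filter, ite_mul, zero_mul]
  rw [sum_comm, krawtchoukTransform]
  refine sum_congr rfl fun a ha => ?_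
  have hIco : {j ∈ range (w + u + 1) | a ≤ j} = Ico a (w + u + 1) := by grind
  rw [← sum_filter, hIco, sum_Ico_eq_sum_range]
  simp only [Nat.add_sub_cancel_left]
  refine sum_subset (by grind) fun b _ hb => ?_
  rw [Nat.choose_eq_zero_of_lt (n := u) (by simpa using hb), Nat.cast_zero, mul_zero, mul_zero,
    zero_mul]

theorem krawtchoukTransform_zero (f : ℕ → R) (u : ℕ) :
    krawtchoukTransform f 0 u = ∑ b ∈ range (u + 1), u.choose b * f b := by
  simp [krawtchoukTransform]

theorem krawtchoukTransform_pow (z : R) (w u : ℕ) :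
    krawtchoukTransform (z ^ ·) w u = (1 - z) ^ w * (1 + z) ^ u := by
  rw [sub_eq_neg_add, add_comm 1 z, add_pow, add_pow, sum_mul_sum, krawtchoukTransform]
  refine sum_congr rfl fun a _ => sum_congr rfl fun b _ => ?_
  rw [neg_pow]
  ring

theorem krawtchoukTransform_eval_eq_zero {P : R[X]} {w : ℕ} (hP : P.natDegree < w) (t u : ℕ) :
    krawtchoukTransform (fun j => P.eval ((t + j : ℕ) : R)) w u = 0 := by
  rw [krawtchoukTransform, sum_comm]
  refine sum_eq_zero fun b _ => ?_
  have hdiff := congrFun (Polynomial.fwdDiff_iter_eq_zero_of_degree_lt hP) ((t + b : ℕ) : R)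
  rw [fwdDiff_iter_eq_sum_shift] at hdiff
  calc ∑ a ∈ range (w + 1), (-1) ^ a * (w.choose a * u.choose b) * P.eval ((t + (a + b) : ℕ) : R)
      = (-1) ^ w * u.choose b * ∑ a ∈ range (w + 1),
          ((-1 : ℤ) ^ (w - a) * w.choose a) • P.eval (((t + b : ℕ) : R) + a • 1) := by
        rw [mul_sum]
        refine sum_congr rfl fun a ha => ?_
        have hsign : (-1 : R) ^ a = (-1) ^ w * (-1) ^ (w - a) := by
          obtain ⟨c, rfl⟩ := Nat.exists_eq_add_of_le (mem_range_succ_iff.1 ha)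
          rw [Nat.add_sub_cancel_left, pow_add, mul_assoc, ← mul_pow, neg_one_mul, neg_neg,
            one_pow, mul_one]
        rw [hsign, zsmul_eq_mul, nsmul_one]
        push_cast
        ring_nf
    _ = 0 := by rw [hdiff, Pi.zero_apply, mul_zero]

theorem sum_powerset_sum_powerset_neg_one_pow_mul {α : Type*} (f : ℕ → R) (y z : Finset α) :
    ∑ A ∈ y.powerset, ∑ B ∈ z.powerset, (-1) ^ #A * f (#A + #B) =
      krawtchoukTransform f #y #z := by
  rw [sum_powerset_apply_card (fun a => ∑ B ∈ z.powerset, (-1) ^ a * f (a + #B)),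
    krawtchoukTransform]
  refine sum_congr rfl fun a _ => ?_
  rw [sum_powerset_apply_card (fun b => (-1) ^ a * f (a + b)), smul_sum]
  refine sum_congr rfl fun b _ => ?_
  simp only [nsmul_eq_mul]
  ring

variable {α : Type*} [Fintype α] [DecidableEq α]

theorem sum_superset_neg_one_pow_mul (f : ℕ → R) (T x : Finset α) :
    ∑ S with T ⊆ S, (-1) ^ #(S ∩ x) * f #S = (-1) ^ #(T ∩ x) *
      krawtchoukTransform (fun j => f (#T + j)) #(x \ T) (Fintype.card α - #(T ∪ x)) := by
  rw [← card_univ_sdiff, ← sum_powerset_sum_powerset_neg_one_pow_mul, ← sum_product', mul_sum]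
  refine sum_nbij' (fun S => (S ∩ (x \ T), S \ (T ∪ x))) (fun p => T ∪ p.1 ∪ p.2)
    (fun S _ => by simp [sdiff_subset_sdiff]) (fun p _ => by grind) (fun S hS => by grind)
    (fun p hp => ?_) (fun S hS => ?_)
  · obtain ⟨hA, hB⟩ : p.1 ⊆ x \ T ∧ p.2 ⊆ univ \ (T ∪ x) := by simpa using hp
    ext <;> grind
  · have hTS : T ⊆ S := (mem_filter.1 hS).2
    have hx : #(S ∩ x) = #(T ∩ x) + #(S ∩ (x \ T)) := by
      rw [← card_union_of_disjoint (disjoint_left.2 (by grind))]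
      congr 1
      grind
    have hS : #S = #T + (#(S ∩ (x \ T)) + #(S \ (T ∪ x))) := by
      rw [← card_union_of_disjoint (disjoint_left.2 (by grind)),
        ← card_union_of_disjoint (disjoint_left.2 (by grind))]
      congr 1
      grind
    rw [hx, pow_add, hS, mul_assoc]

end KrawtchoukTransform

section MacWilliams

variable {α R : Type*} [Fintype α] [DecidableEq α] [CommRing R] {W : Finset (Finset α)}

namespace IsLinearFamily

theorem sum_krawtchoukTransform_sdiff (hW : IsLinearFamily W) (f : ℕ → R) (T : Finset α) :
    ∑ x ∈ W, (-1) ^ #(T ∩ x) *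
        krawtchoukTransform (fun j => f (#T + j)) #(x \ T) (Fintype.card α - #(T ∪ x)) =
      #W * ∑ v ∈ evenDual W with T ⊆ v, f #v := by
  have hpoisson := hW.sum_sum_neg_one_pow_mul (fun S => if T ⊆ S then f #S else 0)
  simp only [mul_ite, mul_zero, ← sum_filter, sum_superset_neg_one_pow_mul] at hpoisson
  exact hpoisson

theorem sum_krawtchoukTransform (hW : IsLinearFamily W) (f : ℕ → R) :
    ∑ x ∈ W, krawtchoukTransform f #x (Fintype.card α - #x) = #W * ∑ v ∈ evenDual W, f #v := by
  simpa using hW.sum_krawtchoukTransform_sdiff f ∅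

theorem card_mul_sum_superset_eval (hW : IsLinearFamily W) {P : R[X]} {T : Finset α}
    (hP : ∀ x ∈ W, x.Nonempty → P.natDegree + #T < #x) :
    #W * ∑ v ∈ evenDual W with T ⊆ v, P.eval (#v : R) =
      ∑ j ∈ range (Fintype.card α - #T + 1),
        (Fintype.card α - #T).choose j * P.eval ((#T + j : ℕ) : R) := by
  rw [← hW.sum_krawtchoukTransform_sdiff (fun j => P.eval (j : R)),
    sum_eq_single_of_mem ∅ hW.empty_mem fun x hx hne => ?_]
  · simp [krawtchoukTransform_zero]
  · have hdeg : P.natDegree < #(x \ T) := by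
      have := hP x hx (nonempty_iff_ne_empty.2 hne)
      have := le_card_sdiff T x
      lia
    rw [krawtchoukTransform_eval_eq_zero hdeg, mul_zero]

theorem card_mul_card_evenDual (hW : IsLinearFamily W) :
    #W * #(evenDual W) = 2 ^ Fintype.card α := by
  have hmoment := hW.card_mul_sum_superset_eval (P := (1 : ℤ[X])) (T := ∅)
    fun x _ hx => by simpa using hx.card_pos
  simp only [eval_one, card_empty, Nat.sub_zero, mul_one, empty_subset, filter_true, sum_const,
    nsmul_one, ← Nat.cast_sum, Nat.sum_range_choose] at hmoment
  exact_mod_cast hmoment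

end IsLinearFamily

theorem isLinearFamily_of_evenDual_eq (hW : evenDual W = W) : IsLinearFamily W :=
  hW ▸ isLinearFamily_evenDual W

theorem univ_mem_of_evenDual_eq (hW : evenDual W = W) : univ ∈ W := by
  rw [← hW, mem_evenDual]
  intro c hc
  rw [univ_inter, ← inter_self c]
  exact mem_evenDual.1 (hW.symm ▸ hc) c hc

theorem card_eq_two_pow_of_evenDual_eq (hW : evenDual W = W) {r : ℕ}
    (hr : Fintype.card α = 2 * r) : #W = 2 ^ r := by
  have hsq := (isLinearFamily_of_evenDual_eq hW).card_mul_card_evenDual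
  rw [hW, hr, pow_mul', ← sq] at hsq
  exact Nat.pow_left_injective two_ne_zero hsq

theorem two_pow_mul_card_superset_mul_eval (hW : evenDual W = W) {r : ℕ}
    (hr : Fintype.card α = 2 * r) {P : ℤ[X]} {k : ℕ} {T : Finset α} (hT : T.Nonempty)
    (hk : k < Fintype.card α) (hdeg : ∀ c ∈ W, c.Nonempty → P.natDegree + #T < #c)
    (hP : ∀ c ∈ W, c.Nonempty → c ≠ univ → #c ≠ k → P.eval (#c : ℤ) = 0) :
    2 ^ r * (#{c ∈ W | #c = k ∧ T ⊆ c} * P.eval (k : ℤ) + P.eval ((2 * r : ℕ) : ℤ)) =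
      ∑ j ∈ range (2 * r - #T + 1), (2 * r - #T).choose j * P.eval ((#T + j : ℕ) : ℤ) := by
  have hmoment := (isLinearFamily_of_evenDual_eq hW).card_mul_sum_superset_eval hdeg
  rw [hW, hr, card_eq_two_pow_of_evenDual_eq hW hr, Nat.cast_pow, Nat.cast_ofNat] at hmoment
  have huniv : univ ∈ {c ∈ W | T ⊆ c} := by simp [univ_mem_of_evenDual_eq hW]
  have hkcard : #{c ∈ W | #c = k ∧ T ⊆ c} = #{c ∈ {c ∈ W | T ⊆ c}.erase univ | #c = k} := by
    congr 1
    ext c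
    have : c = univ → #c ≠ k := by rintro rfl; rw [card_univ]; exact hk.ne'
    simp only [mem_filter, mem_erase]
    tauto
  have hk_sum : ∑ c ∈ {c ∈ W | T ⊆ c}.erase univ, P.eval (#c : ℤ) =
      #{c ∈ W | #c = k ∧ T ⊆ c} * P.eval (k : ℤ) := by
    rw [hkcard, ← nsmul_eq_mul, ← sum_const, sum_filter]
    refine sum_congr rfl fun c hc => ?_
    obtain ⟨hne, hcW, hTc⟩ : c ≠ univ ∧ c ∈ W ∧ T ⊆ c := by simpa using hc
    split_ifs with hck
    · rw [hck]
    · exact hP c hcW (hT.mono hTc) hne hck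
  rw [← hmoment, ← sum_erase_add _ _ huniv, hk_sum, card_univ, hr]

end MacWilliams

section PoissonDefect

/-- The difference between the contributions of a set of size `w` to the two sides of the Poisson
summation formula for `S ↦ f #S` and a self-dual code of length `2 * r`. -/
def poissonDefect (f : ℕ → ℤ) (r w : ℕ) : ℤ :=
  2 ^ r * f w - krawtchoukTransform f w (2 * r - w)

variable {α : Type*} [Fintype α] [DecidableEq α] {W : Finset (Finset α)}

theorem sum_poissonDefect_eq_zero (hW : evenDual W = W) {r : ℕ} (hr : Fintype.card α = 2 * r)
    (f : ℕ → ℤ) : ∑ c ∈ W, poissonDefect f r #c = 0 := by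
  simp only [poissonDefect]
  rw [sum_sub_distrib, ← mul_sum, ← hr,
    (isLinearFamily_of_evenDual_eq hW).sum_krawtchoukTransform, hW,
    card_eq_two_pow_of_evenDual_eq hW hr, Nat.cast_pow, Nat.cast_ofNat, sub_self]

theorem poissonDefect_eval_of_natDegree_lt {P : ℤ[X]} {w : ℕ} (hP : P.natDegree < w) (r : ℕ) :
    poissonDefect (fun j => P.eval (j : ℤ)) r w = 2 ^ r * P.eval (w : ℤ) := by
  have hzero := krawtchoukTransform_eval_eq_zero hP 0 (2 * r - w)
  simp only [zero_add] at hzero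
  rw [poissonDefect, hzero, sub_zero]

end PoissonDefect

section DoublyEven

variable {α : Type*} [Fintype α] [DecidableEq α] {W : Finset (Finset α)}

/-- A family of sets which, identified with its family of indicator vectors, is a doubly even
self-dual binary code. -/
structure IsDoublyEvenSelfDual (W : Finset (Finset α)) : Prop where
  evenDual_eq : evenDual W = W
  four_dvd_card : ∀ c ∈ W, 4 ∣ #c

theorem one_sub_I_pow_mul_one_add_I_pow {r w : ℕ} (hw : 4 ∣ w) (hwr : w ≤ 8 * r) :
    (1 - Complex.I) ^ w * (1 + Complex.I) ^ (8 * r - w) = 16 ^ r := by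
  have hsub : (1 - Complex.I) ^ 4 = -4 := by
    linear_combination (Complex.I ^ 2 - 4 * Complex.I + 5) * Complex.I_sq
  have hadd : (1 + Complex.I) ^ 4 = -4 := by
    linear_combination (Complex.I ^ 2 + 4 * Complex.I + 5) * Complex.I_sq
  obtain ⟨a, rfl⟩ := hw
  rw [show 8 * r - 4 * a = 4 * (2 * r - a) by lia, pow_mul, pow_mul, hsub, hadd, ← pow_add,
    Nat.add_sub_cancel' (by lia), pow_mul]
  norm_num

/-- The Gauss sum of the quadratic form `v ↦ #v / 2` on the dual of a doubly even code. -/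
theorem sum_evenDual_I_pow_card {r : ℕ} (hr : Fintype.card α = 8 * r) (hW : IsLinearFamily W)
    (h4 : ∀ c ∈ W, 4 ∣ #c) : ∑ v ∈ evenDual W, Complex.I ^ #v = 16 ^ r := by
  have hcard : (#W : ℂ) ≠ 0 := mod_cast (card_pos.2 ⟨∅, hW.empty_mem⟩).ne'
  have hterm : ∀ c ∈ W, krawtchoukTransform (Complex.I ^ ·) #c (Fintype.card α - #c) = 16 ^ r := by
    intro c hc
    rw [krawtchoukTransform_pow, hr]
    exact one_sub_I_pow_mul_one_add_I_pow (h4 c hc) (hr ▸ card_le_univ c)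
  refine mul_left_cancel₀ hcard ?_
  rw [← hW.sum_krawtchoukTransform (Complex.I ^ ·), sum_congr rfl hterm, sum_const, nsmul_eq_mul]

theorem I_pow_of_even {w : ℕ} (hw : Even w) : Complex.I ^ w = if 4 ∣ w then 1 else -1 := by
  obtain ⟨t, rfl⟩ := even_iff_exists_two_mul.1 hw
  rw [pow_mul, Complex.I_sq]
  split_ifs with h
  · exact Even.neg_one_pow (by grind)
  · exact Odd.neg_one_pow (by grind)

theorem isLinearFamily_of_mem_iff (hW : ∀ v, v ∈ W ↔ 4 ∣ #v ∧ v ∈ evenDual W) :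
    IsLinearFamily W where
  empty_mem := (hW ∅).2 ⟨by simp, (isLinearFamily_evenDual W).empty_mem⟩
  symmDiff_mem a ha b hb := by
    have ha' := (hW a).1 ha
    have hb' := (hW b).1 hb
    exact (hW _).2 ⟨four_dvd_card_symmDiff ha'.1 hb'.1 (mem_evenDual.1 ha'.2 b hb),
      (isLinearFamily_evenDual W).symmDiff_mem a ha'.2 b hb'.2⟩

/-- The Gauss sum `16 ^ r` is the difference between the numbers of dual vectors of weights `0` and
`2` modulo `4`, so the former, which are the elements of `W`, are in the majority. -/
theorem evenDual_eq_of_mem_iff {r : ℕ} (hr : Fintype.card α = 8 * r)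
    (hW : ∀ v, v ∈ W ↔ 4 ∣ #v ∧ v ∈ evenDual W) : evenDual W = W := by
  have hlin := isLinearFamily_of_mem_iff hW
  have hdual := isLinearFamily_evenDual W
  have hsub : W ⊆ evenDual W := fun v hv => ((hW v).1 hv).2
  have huniv : univ ∈ W := by
    refine (hW univ).2 ⟨⟨2 * r, by rw [card_univ, hr]; ring⟩, mem_evenDual.2 fun c hc => ?_⟩
    rw [univ_inter, even_iff_two_dvd]
    exact (by norm_num : 2 ∣ 4).trans ((hW c).1 hc).1
  have hpow : ∀ v ∈ evenDual W, Complex.I ^ #v = if v ∈ W then 1 else -1 := by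
    intro v hv
    have heven : Even #v := by simpa using mem_evenDual.1 hv univ huniv
    simp only [I_pow_of_even heven, hW v, hv, and_true]
  have hgauss : (#W : ℤ) - #(evenDual W \ W) = 16 ^ r := by
    have hsum := sum_evenDual_I_pow_card hr hlin fun c hc => ((hW c).1 hc).1
    rw [sum_congr rfl hpow, sum_ite, filter_mem_eq_inter, inter_eq_right.2 hsub,
      filter_notMem_eq_sdiff, sum_const, sum_const, nsmul_one, nsmul_eq_mul, mul_neg_one,
      ← sub_eq_add_neg] at hsum
    exact_mod_cast hsum
  refine (hsub.antisymm fun v hv => ?_).symm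
  by_contra hvW
  have hle : #W ≤ #(evenDual W \ W) := by
    refine card_le_card_of_injOn (· ∆ v) (fun c hc => mem_coe.2 (mem_sdiff.2 ⟨?_, fun h => hvW ?_⟩))
      (symmDiff_left_injective v).injOn
    · exact hdual.symmDiff_mem c (hsub hc) v hv
    · simpa using hlin.symmDiff_mem c hc _ h
  have hpos : (0 : ℤ) < 16 ^ r := by positivity
  lia

theorem exists_isDoublyEvenSelfDual_superset {r : ℕ} (hr : Fintype.card α = 8 * r)
    {B : Finset (Finset α)} (h4 : ∀ b ∈ B, 4 ∣ #b) (hB : B ⊆ evenDual B) :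
    ∃ W, B ⊆ W ∧ IsDoublyEvenSelfDual W := by
  obtain ⟨W, hBW, hmax⟩ := (Set.toFinite {W : Finset (Finset α) |
    (∀ b ∈ W, 4 ∣ #b) ∧ W ⊆ evenDual W}).exists_le_maximal (a := B) ⟨h4, hB⟩
  obtain ⟨hW4, hW⟩ := hmax.prop
  refine ⟨W, hBW, evenDual_eq_of_mem_iff hr fun v => ⟨fun hv => ⟨hW4 v hv, hW hv⟩, ?_⟩, hW4⟩
  rintro ⟨hv4, hv⟩
  have hv_even : Even #v := even_iff_two_dvd.2 ((by norm_num : 2 ∣ 4).trans hv4)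
  have hinsert : insert v W ⊆ evenDual (insert v W) := by
    simp only [subset_iff, mem_evenDual, mem_insert] at hW hv ⊢
    grind
  exact hmax.le_of_ge ⟨(forall_mem_insert _ _ _).2 ⟨hv4, hW4⟩, hinsert⟩ (subset_insert v W)
    (mem_insert_self v W)

end DoublyEven

section Design

/-- The number of blocks of a `t`-`(v,k,lam)` design through `i ≤ t` given points, usually denoted
`λᵢ`. -/
def blockNumber (t v k lam i : ℕ) : ℕ := lam * (v - i).choose (t - i) / (k - i).choose (t - i)

variable {X : Type*} [DecidableEq X]

theorem sum_choose_card_inter_eq_sum_card_superset (B : Finset (Finset X)) (x : Finset X) (i : ℕ) :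
    ∑ b ∈ B, (#(b ∩ x)).choose i = ∑ I ∈ powersetCard i x, #{b ∈ B | I ⊆ b} := by
  have hcount := sum_card_bipartiteAbove_eq_sum_card_bipartiteBelow
    (s := powersetCard i x) (t := B) (fun I b => I ⊆ b)
  refine Eq.trans (sum_congr rfl fun b _ => ?_) hcount.symm
  rw [← card_powersetCard, bipartiteBelow]
  congr 1
  ext I
  simp only [mem_powersetCard, mem_filter, subset_inter_iff]
  tauto

variable [Fintype X] {t v k lam : ℕ} {B : Finset (Finset X)}

namespace IsDesign

theorem card_superset_mul_choose (hB : IsDesign t v k lam B) {I : Finset X} (hI : #I ≤ t) :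
    #{b ∈ B | I ⊆ b} * (k - #I).choose (t - #I) = lam * (v - #I).choose (t - #I) := by
  have hcount := sum_card_bipartiteAbove_eq_sum_card_bipartiteBelow
    (s := {T ∈ powersetCard t (univ : Finset X) | I ⊆ T}) (t := {b ∈ B | I ⊆ b}) (fun T b => T ⊆ b)
  have hblocks : ∀ T ∈ {T ∈ powersetCard t (univ : Finset X) | I ⊆ T},
      #(bipartiteAbove (fun T b => T ⊆ b) {b ∈ B | I ⊆ b} T) = lam := by
    intro T hT
    obtain ⟨hTcard, hIT⟩ : #T = t ∧ I ⊆ T := by simpa using hT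
    rw [← hB.balanced T hTcard, bipartiteAbove, filter_filter]
    congr 1
    exact filter_congr fun b _ => and_iff_right_of_imp hIT.trans
  have hsets : ∀ b ∈ {b ∈ B | I ⊆ b},
      #(bipartiteBelow (fun T b => T ⊆ b) {T ∈ powersetCard t (univ : Finset X) | I ⊆ T} b) =
        (k - #I).choose (t - #I) := by
    intro b hb
    obtain ⟨hbB, hIb⟩ := mem_filter.1 hb
    rw [← hB.card_block b hbB, ← card_filter_powersetCard_subset I b t hIb hI]
    congr 1
    ext T
    simp only [bipartiteBelow, mem_filter, mem_powersetCard, subset_univ, true_and]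
    tauto
  rw [sum_congr rfl hblocks, sum_congr rfl hsets, sum_const, sum_const,
    card_filter_powersetCard_subset I univ t (subset_univ I) hI, card_univ, hB.card_points,
    smul_eq_mul, smul_eq_mul] at hcount
  rw [← hcount, mul_comm]

theorem card_superset (hB : IsDesign t v k lam B) (htk : t ≤ k) {I : Finset X} (hI : #I ≤ t) :
    #{b ∈ B | I ⊆ b} = blockNumber t v k lam #I :=
  Nat.eq_div_of_mul_eq_left (Nat.choose_pos (by lia)).ne' (hB.card_superset_mul_choose hI)

theorem card_eq (hB : IsDesign t v k lam B) (htk : t ≤ k) : #B = blockNumber t v k lam 0 := by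
  simpa using hB.card_superset htk (I := ∅) (by simp)

theorem sum_choose_card_inter (hB : IsDesign t v k lam B) (htk : t ≤ k) (x : Finset X) {i : ℕ}
    (hi : i ≤ t) :
    ∑ b ∈ B, (#(b ∩ x)).choose i = (#x).choose i * blockNumber t v k lam i := by
  rw [sum_choose_card_inter_eq_sum_card_superset, ← card_powersetCard, ← smul_eq_mul, ← sum_const]
  refine sum_congr rfl fun I hI => ?_
  have hIcard : #I = i := (mem_powersetCard.1 hI).2
  rw [hB.card_superset htk (hIcard.trans_le hi), hIcard]

end IsDesign

/-- Newton's expansion of `s * (s - 2) * (s - 4) * (s - 6) * (s - 8) / 15`, without subtraction. -/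
theorem choose_relation_of_even {s : ℕ} (hs : Even s) (hs8 : s ≤ 8) :
    7 * s.choose 1 + 18 * s.choose 3 + 8 * s.choose 5 =
      14 * s.choose 2 + 16 * s.choose 4 := by
  interval_cases s <;> first | rfl | exact absurd hs (by decide)

theorem IsDesign.blockNumber_relation (hB : IsDesign 5 v k lam B) (hk : 5 ≤ k) {x : Finset X}
    (hx : #x ≤ 8) (heven : ∀ b ∈ B, Even #(b ∩ x)) :
    7 * ((#x).choose 1 * blockNumber 5 v k lam 1) + 18 * ((#x).choose 3 * blockNumber 5 v k lam 3) +
        8 * ((#x).choose 5 * blockNumber 5 v k lam 5) =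
      14 * ((#x).choose 2 * blockNumber 5 v k lam 2) +
        16 * ((#x).choose 4 * blockNumber 5 v k lam 4) := by
  have hmoment (i : ℕ) (hi : i ≤ 5) := hB.sum_choose_card_inter hk x hi
  rw [← hmoment 1 (by simp), ← hmoment 2 (by simp), ← hmoment 3 (by simp), ← hmoment 4 (by simp),
    ← hmoment 5 le_rfl]
  simp only [mul_sum, ← sum_add_distrib]
  exact sum_congr rfl fun b hb =>
    choose_relation_of_even (heven b hb) ((card_le_card inter_subset_right).trans hx)

end Design

section DesignParameters

/-- The multiples of `4` strictly between `4 * m` and `20 * m`: the weights other than `0` and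
`24 * m` of an extremal doubly even self-dual code of length `24 * m`. -/
def middleWeights (m : ℕ) : Finset ℕ := (Ioo m (5 * m)).image (4 * ·)

theorem mem_middleWeights {m w : ℕ} :
    w ∈ middleWeights m ↔ 4 ∣ w ∧ 4 * m < w ∧ w < 20 * m := by
  simp only [middleWeights, mem_image, mem_Ioo]
  exact ⟨by lia, fun ⟨⟨i, hi⟩, _⟩ => ⟨i, by lia⟩⟩

theorem card_middleWeights (m : ℕ) : #(middleWeights m) = 4 * m - 1 := by
  rw [middleWeights, card_image_of_injective _ (mul_right_injective₀ four_ne_zero), Nat.card_Ioo]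
  lia

/-- The monic polynomial whose roots are the middle weights other than `k`. -/
noncomputable def weightPoly (m k : ℕ) : ℤ[X] := ∏ w ∈ (middleWeights m).erase k, (X - C (w : ℤ))

theorem eval_weightPoly (m k : ℕ) (x : ℤ) :
    (weightPoly m k).eval x = ∏ w ∈ (middleWeights m).erase k, (x - w) := by
  simp [weightPoly, eval_prod]

theorem natDegree_weightPoly {m k : ℕ} (hk : k ∈ middleWeights m) :
    (weightPoly m k).natDegree = 4 * m - 2 := by
  rw [weightPoly, natDegree_finsetProd_X_sub_C_eq_card, card_erase_of_mem hk, card_middleWeights]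
  lia

theorem eval_weightPoly_eq_zero_iff {m k w : ℕ} :
    (weightPoly m k).eval (w : ℤ) = 0 ↔ w ≠ k ∧ w ∈ middleWeights m := by
  simp only [eval_weightPoly, prod_eq_zero_iff, sub_eq_zero, Nat.cast_inj, exists_eq_right',
    mem_erase]

/-- The Poisson defect of the weight polynomial for self-dual codes of length `24 * m`. -/
noncomputable def weightDefect (m k w : ℕ) : ℤ :=
  poissonDefect (fun j => (weightPoly m k).eval (j : ℤ)) (12 * m) w

theorem weightDefect_of_four_mul_le {m k w : ℕ} (hk : k ∈ middleWeights m) (hw : 4 * m ≤ w) :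
    weightDefect m k w = 2 ^ (12 * m) * (weightPoly m k).eval (w : ℤ) := by
  have hm := mem_middleWeights.1 hk
  exact poissonDefect_eval_of_natDegree_lt (by rw [natDegree_weightPoly hk]; lia) _

/-- The values of `(m, k, lam)` for which self-orthogonal `5`-`(24 * m, k, lam)` designs are
considered. -/
inductive IsDesignParameters : ℕ → ℕ → ℕ → Prop
  | length72_block24 : IsDesignParameters 3 24 1406405
  | length72_block32 : IsDesignParameters 3 32 238957796
  | length96_block36 : IsDesignParameters 4 36 28080500448
  | length96_block44 : IsDesignParameters 4 44 1167789832440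
  | length120_block56 : IsDesignParameters 5 56 5156299310025435
  | length144_block68 : IsDesignParameters 6 68 21788133027489299328

namespace IsDesignParameters

variable {m k lam : ℕ}

theorem blockSize_mem_middleWeights (h : IsDesignParameters m k lam) : k ∈ middleWeights m := by
  cases h <;> decide

theorem blockNumber_relation_ne (h : IsDesignParameters m k lam) {w : ℕ} (hw : w = 4 ∨ w = 8) :
    7 * (w.choose 1 * blockNumber 5 (24 * m) k lam 1) +
        18 * (w.choose 3 * blockNumber 5 (24 * m) k lam 3) +
        8 * (w.choose 5 * blockNumber 5 (24 * m) k lam 5) ≠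
      14 * (w.choose 2 * blockNumber 5 (24 * m) k lam 2) +
        16 * (w.choose 4 * blockNumber 5 (24 * m) k lam 4) := by
  rcases hw with rfl | rfl <;> cases h <;> decide +kernel

theorem eval_weightPoly_nonneg (h : IsDesignParameters m k lam) :
    ∀ i < 6 * m, 0 ≤ (weightPoly m k).eval ((4 * i : ℕ) : ℤ) := by
  simp only [eval_weightPoly]
  cases h <;> decide +kernel

theorem weightDefect_pos_of_lt (h : IsDesignParameters m k lam) :
    ∀ i < m, 3 ≤ i → 0 < weightDefect m k (4 * i) := by
  -- Evaluating `Nat.choose` by its recursion would take exponential time.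
  simp only [weightDefect, eval_weightPoly, poissonDefect, krawtchoukTransform_eq_sum_range,
    Nat.choose_eq_descFactorial_div_factorial]
  cases h <;> decide +kernel

theorem two_pow_mul_eval_add_eval_add_blockNumber_mul_eval (h : IsDesignParameters m k lam) :
    2 ^ (12 * m) * ((weightPoly m k).eval 0 + (weightPoly m k).eval ((24 * m : ℕ) : ℤ) +
        blockNumber 5 (24 * m) k lam 0 * (weightPoly m k).eval (k : ℤ)) =
      ∑ j ∈ range (24 * m + 1), (24 * m).choose j * (weightPoly m k).eval (j : ℤ) := by
  simp only [eval_weightPoly, blockNumber, Nat.choose_eq_descFactorial_div_factorial]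
  cases h <;> decide +kernel

theorem two_pow_mul_lam_mul_eval_add_eval (h : IsDesignParameters m k lam) :
    2 ^ (12 * m) * (lam * (weightPoly m k).eval (k : ℤ) +
        (weightPoly m k).eval ((24 * m : ℕ) : ℤ)) =
      ∑ j ∈ range (24 * m - 5 + 1),
        (24 * m - 5).choose j * (weightPoly m k).eval ((5 + j : ℕ) : ℤ) := by
  simp only [eval_weightPoly, Nat.choose_eq_descFactorial_div_factorial]
  cases h <;> decide +kernel

theorem two_pow_mul_eval_ne (h : IsDesignParameters m k lam) :
    2 ^ (12 * m) * (weightPoly m (4 * m + 4)).eval ((24 * m : ℕ) : ℤ) ≠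
      ∑ j ∈ range (24 * m - 5 + 1),
        (24 * m - 5).choose j * (weightPoly m (4 * m + 4)).eval ((5 + j : ℕ) : ℤ) := by
  simp only [eval_weightPoly, Nat.choose_eq_descFactorial_div_factorial]
  cases h <;> decide +kernel

theorem weightDefect_nonneg_of_four_mul_le (h : IsDesignParameters m k lam) {w : ℕ} (h4 : 4 ∣ w)
    (hw : 4 * m ≤ w) (hwm : w < 24 * m) : 0 ≤ weightDefect m k w := by
  obtain ⟨i, rfl⟩ := h4
  rw [weightDefect_of_four_mul_le h.blockSize_mem_middleWeights hw]
  exact mul_nonneg (by positivity) (h.eval_weightPoly_nonneg i (by lia))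

theorem weightDefect_pos_of_le_four_mul (h : IsDesignParameters m k lam) {w : ℕ} (h4 : 4 ∣ w)
    (hw12 : 12 ≤ w) (hw : w ≤ 4 * m) : 0 < weightDefect m k w := by
  rcases hw.lt_or_eq with hlt | rfl
  · obtain ⟨i, rfl⟩ := h4
    exact h.weightDefect_pos_of_lt i (by lia) (by lia)
  · have hne : (weightPoly m k).eval ((4 * m : ℕ) : ℤ) ≠ 0 := by
      rw [Ne, eval_weightPoly_eq_zero_iff, mem_middleWeights]
      lia
    refine (h.weightDefect_nonneg_of_four_mul_le h4 le_rfl (by lia)).lt_of_ne' ?_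
    rw [weightDefect_of_four_mul_le h.blockSize_mem_middleWeights le_rfl]
    exact mul_ne_zero (by positivity) hne

theorem weightDefect_zero_add_add (h : IsDesignParameters m k lam) :
    weightDefect m k 0 + weightDefect m k (24 * m) +
      blockNumber 5 (24 * m) k lam 0 * weightDefect m k k = 0 := by
  have hk := h.blockSize_mem_middleWeights
  rw [weightDefect_of_four_mul_le hk (w := 24 * m) (by lia),
    weightDefect_of_four_mul_le hk (mem_middleWeights.1 hk).2.1.le,
    weightDefect, poissonDefect, krawtchoukTransform_zero, Nat.sub_zero, Nat.cast_zero,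
    show 2 * (12 * m) = 24 * m by ring, ← h.two_pow_mul_eval_add_eval_add_blockNumber_mul_eval]
  ring

end IsDesignParameters

end DesignParameters

section ExtremalFamily

variable {α : Type*} [Fintype α] [DecidableEq α] {W : Finset (Finset α)} {m k lam : ℕ}

namespace IsDoublyEvenSelfDual

theorem compl_mem (hW : IsDoublyEvenSelfDual W) {c : Finset α} (hc : c ∈ W) : cᶜ ∈ W := by
  have huniv := univ_mem_of_evenDual_eq hW.evenDual_eq
  have hsymm := (isLinearFamily_of_evenDual_eq hW.evenDual_eq).symmDiff_mem univ huniv c hc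
  rwa [← top_eq_univ, top_symmDiff, hnot_eq_compl] at hsymm

theorem card_mem_middleWeights (hW : IsDoublyEvenSelfDual W) (hm : Fintype.card α = 24 * m)
    (hd : ∀ c ∈ W, c.Nonempty → 4 * m < #c) {c : Finset α} (hc : c ∈ W) (hne : c.Nonempty)
    (huniv : c ≠ univ) : #c ∈ middleWeights m := by
  have hcompl := hd cᶜ (hW.compl_mem hc)
    (nonempty_iff_ne_empty.2 ((compl_eq_empty_iff c).not.2 huniv))
  rw [card_compl, hm] at hcompl
  exact mem_middleWeights.2 ⟨hW.four_dvd_card c hc, hd c hc hne, by lia⟩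

theorem two_pow_mul_card_superset_mul_eval_weightPoly (hW : IsDoublyEvenSelfDual W)
    (hm : Fintype.card α = 24 * m) (hd : ∀ c ∈ W, c.Nonempty → 4 * m < #c)
    (hk : k ∈ middleWeights m) {T : Finset α} (hT : #T = 5) :
    2 ^ (12 * m) * (#{c ∈ W | #c = k ∧ T ⊆ c} * (weightPoly m k).eval (k : ℤ) +
        (weightPoly m k).eval ((24 * m : ℕ) : ℤ)) =
      ∑ j ∈ range (24 * m - 5 + 1),
        (24 * m - 5).choose j * (weightPoly m k).eval ((5 + j : ℕ) : ℤ) := by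
  obtain ⟨-, hk_gt, hk_lt⟩ := mem_middleWeights.1 hk
  have hdeg : ∀ c ∈ W, c.Nonempty → (weightPoly m k).natDegree + #T < #c := by
    intro c hc hne
    have h4 := hW.four_dvd_card c hc
    have hgt := hd c hc hne
    rw [natDegree_weightPoly hk, hT]
    lia
  have hroot : ∀ c ∈ W, c.Nonempty → c ≠ univ → #c ≠ k → (weightPoly m k).eval (#c : ℤ) = 0 :=
    fun c hc hne huniv hck =>
      eval_weightPoly_eq_zero_iff.2 ⟨hck, hW.card_mem_middleWeights hm hd hc hne huniv⟩
  have hcount := two_pow_mul_card_superset_mul_eval hW.evenDual_eq (r := 12 * m) (by lia)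
    (card_pos.1 (by lia)) (by lia) hdeg hroot
  rwa [hT, show 2 * (12 * m) = 24 * m by ring] at hcount

theorem card_superset_eq (hW : IsDoublyEvenSelfDual W) (h : IsDesignParameters m k lam)
    (hm : Fintype.card α = 24 * m) (hd : ∀ c ∈ W, c.Nonempty → 4 * m < #c)
    {T : Finset α} (hT : #T = 5) : #{c ∈ W | #c = k ∧ T ⊆ c} = lam := by
  have hk : (weightPoly m k).eval (k : ℤ) ≠ 0 := by simp [eval_weightPoly_eq_zero_iff]
  have hcount :=
    hW.two_pow_mul_card_superset_mul_eval_weightPoly hm hd h.blockSize_mem_middleWeights hT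
  rw [← h.two_pow_mul_lam_mul_eval_add_eval, mul_right_inj' (by positivity), add_left_inj,
    mul_left_inj' hk] at hcount
  exact_mod_cast hcount

theorem isSelfOrthogonalDesign (hW : IsDoublyEvenSelfDual W) (h : IsDesignParameters m k lam)
    (hm : Fintype.card α = 24 * m) (hd : ∀ c ∈ W, c.Nonempty → 4 * m < #c) :
    IsSelfOrthogonalDesign 5 (24 * m) k lam {c ∈ W | #c = k} where
  card_points := hm
  card_block _ hb := (mem_filter.1 hb).2
  balanced T hT := by
    rw [filter_filter]
    exact hW.card_superset_eq h hm hd hT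
  inter_parity a ha b hb _ := by
    have hab : Even #(a ∩ b) :=
      mem_evenDual.1 (hW.evenDual_eq.symm ▸ (mem_filter.1 ha).1) b (mem_filter.1 hb).1
    have hk := (mem_middleWeights.1 h.blockSize_mem_middleWeights).1
    rw [Nat.ModEq]
    grind

theorem exists_card_eq_four_mul_add_four (hW : IsDoublyEvenSelfDual W)
    (h : IsDesignParameters m k lam) (hm : Fintype.card α = 24 * m)
    (hd : ∀ c ∈ W, c.Nonempty → 4 * m < #c) : ∃ c ∈ W, #c = 4 * m + 4 := by
  have hk := mem_middleWeights.1 h.blockSize_mem_middleWeights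
  have hmin : 4 * m + 4 ∈ middleWeights m := mem_middleWeights.2 (by lia)
  obtain ⟨T, hT⟩ : ∃ T : Finset α, #T = 5 := by
    obtain ⟨T, -, hT⟩ := exists_subset_card_eq (s := (univ : Finset α)) (n := 5)
      (by rw [card_univ]; lia)
    exact ⟨T, hT⟩
  by_contra! hnone
  have hempty : {c ∈ W | #c = 4 * m + 4 ∧ T ⊆ c} = ∅ :=
    filter_eq_empty_iff.2 fun c hc hcard => hnone c hc hcard.1
  have hcount := hW.two_pow_mul_card_superset_mul_eval_weightPoly hm hd hmin hT
  rw [hempty, card_empty, Nat.cast_zero, zero_mul, zero_add] at hcount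
  exact h.two_pow_mul_eval_ne hcount

end IsDoublyEvenSelfDual

end ExtremalFamily

section SpanOfDesign

variable {X : Type*} [Fintype X] [DecidableEq X] {B W : Finset (Finset X)} {m k lam : ℕ}

namespace IsSelfOrthogonalDesign

theorem even_card_inter {t v : ℕ} (hB : IsSelfOrthogonalDesign t v k lam B) (hk : Even k)
    {a b : Finset X} (ha : a ∈ B) (hb : b ∈ B) : Even #(a ∩ b) := by
  by_cases hab : a = b
  · rwa [hab, inter_self, hB.card_block b hb]
  · have hparity : #(a ∩ b) % 2 = k % 2 := hB.inter_parity a ha b hb hab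
    grind

theorem exists_isDoublyEvenSelfDual_superset {t v r : ℕ}
    (hB : IsSelfOrthogonalDesign t v k lam B) (hv : v = 8 * r) (hk : 4 ∣ k) :
    ∃ W, B ⊆ W ∧ IsDoublyEvenSelfDual W :=
  _root_.exists_isDoublyEvenSelfDual_superset (hB.card_points.trans hv)
    (fun b hb => (hB.card_block b hb).symm ▸ hk)
    fun _ ha => mem_evenDual.2 fun _ hb => hB.even_card_inter (by grind) ha hb

end IsSelfOrthogonalDesign

namespace IsDesign

theorem card_ne_four_and_card_ne_eight (hB : IsDesign 5 (24 * m) k lam B)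
    (h : IsDesignParameters m k lam) (hW : evenDual W = W) (hBW : B ⊆ W) {c : Finset X}
    (hc : c ∈ W) : #c ≠ 4 ∧ #c ≠ 8 := by
  by_contra hsmall
  have hk := mem_middleWeights.1 h.blockSize_mem_middleWeights
  have heven : ∀ b ∈ B, Even #(b ∩ c) := fun b hb => mem_evenDual.1 (hW.symm ▸ hBW hb) c hc
  exact h.blockNumber_relation_ne (w := #c) (by lia)
    (hB.blockNumber_relation (by lia) (by lia) heven)

theorem twelve_le_card (hB : IsDesign 5 (24 * m) k lam B) (h : IsDesignParameters m k lam)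
    (hW : IsDoublyEvenSelfDual W) (hBW : B ⊆ W) {c : Finset X} (hc : c ∈ W) (hne : c.Nonempty) :
    12 ≤ #c := by
  have h48 := hB.card_ne_four_and_card_ne_eight h hW.evenDual_eq hBW hc
  have h4 := hW.four_dvd_card c hc
  have hpos := hne.card_pos
  lia

theorem sum_weightDefect_insert_empty_insert_univ (hB : IsDesign 5 (24 * m) k lam B)
    (h : IsDesignParameters m k lam) :
    ∑ c ∈ insert ∅ (insert univ B), weightDefect m k #c = 0 := by
  have hk := mem_middleWeights.1 h.blockSize_mem_middleWeights
  have huniv : #(univ : Finset X) = 24 * m := by rw [card_univ, hB.card_points]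
  have hunivB : univ ∉ B := fun hmem => by have := hB.card_block _ hmem; lia
  have hemptyB : ∅ ∉ insert univ B := by
    refine fun hmem => (mem_insert.1 hmem).elim (fun heq => ?_) fun hmem => ?_
    · rw [← heq, card_empty] at huniv
      lia
    · have := hB.card_block _ hmem
      rw [card_empty] at this
      lia
  rw [sum_insert hemptyB, sum_insert hunivB, sum_congr rfl fun b hb => by rw [hB.card_block b hb],
    sum_const, nsmul_eq_mul, hB.card_eq (by lia), huniv, card_empty, ← add_assoc,
    h.weightDefect_zero_add_add]

/-- The defects of `∅`, of `univ` and of the blocks already add up to zero, so there is no room for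
a further member with positive defect. -/
theorem four_mul_lt_card (hB : IsDesign 5 (24 * m) k lam B) (h : IsDesignParameters m k lam)
    (hW : IsDoublyEvenSelfDual W) (hBW : B ⊆ W) : ∀ c ∈ W, c.Nonempty → 4 * m < #c := by
  intro c₀ hc₀ hne₀
  by_contra! hle₀
  have hk := mem_middleWeights.1 h.blockSize_mem_middleWeights
  have huniv : #(univ : Finset X) = 24 * m := by rw [card_univ, hB.card_points]
  have hsub : insert ∅ (insert univ B) ⊆ W := insert_subset_iff.2
    ⟨(isLinearFamily_of_evenDual_eq hW.evenDual_eq).empty_mem,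
      insert_subset_iff.2 ⟨univ_mem_of_evenDual_eq hW.evenDual_eq, hBW⟩⟩
  have hpos₀ : 0 < weightDefect m k #c₀ :=
    h.weightDefect_pos_of_le_four_mul (hW.four_dvd_card c₀ hc₀)
      (hB.twelve_le_card h hW hBW hc₀ hne₀) hle₀
  have hnotMem₀ : c₀ ∉ insert ∅ (insert univ B) := by
    have hblock := hB.card_block c₀
    grind
  have hnonneg : ∀ c ∈ W \ insert ∅ (insert univ B), 0 ≤ weightDefect m k #c := by
    intro c hc
    obtain ⟨hcW, hne, hcu⟩ : c ∈ W ∧ c.Nonempty ∧ c ≠ univ := by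
      grind [nonempty_iff_ne_empty]
    have h4 := hW.four_dvd_card c hcW
    have hlt : #c < 24 * m := huniv ▸ card_lt_card (ssubset_univ_iff.2 hcu)
    rcases le_total #c (4 * m) with hle | hge
    · exact (h.weightDefect_pos_of_le_four_mul h4 (hB.twelve_le_card h hW hBW hcW hne) hle).le
    · exact h.weightDefect_nonneg_of_four_mul_le h4 hge hlt
  have hrest := sum_pos' hnonneg ⟨c₀, mem_sdiff.2 ⟨hc₀, hnotMem₀⟩, hpos₀⟩
  have htotal : ∑ c ∈ W, weightDefect m k #c = 0 :=
    sum_poissonDefect_eq_zero hW.evenDual_eq (by rw [hB.card_points]; ring) _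
  rw [← sum_sdiff hsub, hB.sum_weightDefect_insert_empty_insert_univ h, add_zero] at htotal
  exact hrest.ne' htotal

end IsDesign

end SpanOfDesign

section Supports

variable {n : ℕ}

/-- Binary words of length `n` correspond to sets of coordinates, by taking supports. -/
def supportEquiv (n : ℕ) : (Fin n → ZMod 2) ≃ Finset (Fin n) where
  toFun x := {i | x i ≠ 0}
  invFun s i := if i ∈ s then 1 else 0
  left_inv x := by
    have hbit : ∀ a : ZMod 2, (if a ≠ 0 then 1 else 0) = a := by decide
    funext i
    simpa using hbit (x i)
  right_inv s := by
    ext i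
    simp

theorem mem_supportEquiv {x : Fin n → ZMod 2} {i : Fin n} : i ∈ supportEquiv n x ↔ x i ≠ 0 := by
  simp [supportEquiv]

theorem hammingNorm_eq_card_supportEquiv (x : Fin n → ZMod 2) :
    hammingNorm x = #(supportEquiv n x) := rfl

theorem supportEquiv_zero : supportEquiv n 0 = ∅ := by
  ext i
  simp [mem_supportEquiv]

theorem supportEquiv_nonempty {x : Fin n → ZMod 2} : (supportEquiv n x).Nonempty ↔ x ≠ 0 := by
  rw [nonempty_iff_ne_empty, ← supportEquiv_zero, (supportEquiv n).injective.ne_iff]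

theorem supportEquiv_add (x y : Fin n → ZMod 2) :
    supportEquiv n (x + y) = supportEquiv n x ∆ supportEquiv n y := by
  have hbit : ∀ a b : ZMod 2, a + b ≠ 0 ↔ a ≠ 0 ∧ ¬b ≠ 0 ∨ b ≠ 0 ∧ ¬a ≠ 0 := by decide
  ext i
  simpa only [mem_symmDiff, mem_supportEquiv, Pi.add_apply] using hbit (x i) (y i)

theorem dotProduct_eq_zero_iff_even_card_inter (x y : Fin n → ZMod 2) :
    x ⬝ᵥ y = 0 ↔ Even #(supportEquiv n x ∩ supportEquiv n y) := by
  have hbit : ∀ a b : ZMod 2, a * b = if a ≠ 0 ∧ b ≠ 0 then 1 else 0 := by decide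
  have hinter : ({i | x i ≠ 0 ∧ y i ≠ 0} : Finset (Fin n)) = supportEquiv n x ∩ supportEquiv n y :=
    filter_and _ _ _
  rw [dotProduct, sum_congr rfl fun i _ => hbit (x i) (y i), ← sum_filter, sum_const, nsmul_one,
    hinter, ZMod.natCast_eq_zero_iff_even]

/-- The code whose codewords have the members of a linear family as supports. -/
def IsLinearFamily.toBinaryCode {W : Finset (Finset (Fin n))} (hW : IsLinearFamily W) :
    BinaryCode n where
  carrier := {x | supportEquiv n x ∈ W}
  zero_mem' := by simpa [supportEquiv_zero] using hW.empty_mem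
  add_mem' hx hy := by simpa [supportEquiv_add] using hW.symmDiff_mem _ hx _ hy
  smul_mem' a x hx := by
    have ha : a = 0 ∨ a = 1 := by decide +revert
    rcases ha with rfl | rfl
    · simpa [supportEquiv_zero] using hW.empty_mem
    · simpa using hx

namespace BinaryCode

/-- `W` is the family of supports of the codewords of `C`. -/
def HasSupports (C : BinaryCode n) (W : Finset (Finset (Fin n))) : Prop :=
  ∀ x, x ∈ C ↔ supportEquiv n x ∈ W

namespace HasSupports

variable {C : BinaryCode n} {W : Finset (Finset (Fin n))}

theorem forall_mem_iff (h : C.HasSupports W) {p : Finset (Fin n) → Prop} :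
    (∀ x ∈ C, p (supportEquiv n x)) ↔ ∀ s ∈ W, p s :=
  (supportEquiv n).forall_congr fun x => imp_congr_left (h x)

theorem exists_mem_iff (h : C.HasSupports W) {p : Finset (Fin n) → Prop} :
    (∃ x ∈ C, p (supportEquiv n x)) ↔ ∃ s ∈ W, p s :=
  (supportEquiv n).exists_congr fun x => and_congr_left' (h x)

theorem mem_dual_iff (h : C.HasSupports W) {x : Fin n → ZMod 2} :
    x ∈ C.dual ↔ supportEquiv n x ∈ evenDual W := by
  rw [mem_evenDual, ← h.forall_mem_iff]
  exact forall₂_congr fun c _ => dotProduct_eq_zero_iff_even_card_inter x c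

theorem isSelfDual_iff (h : C.HasSupports W) : C.IsSelfDual ↔ evenDual W = W := by
  rw [IsSelfDual, eq_comm, SetLike.ext_iff, Finset.ext_iff]
  exact (supportEquiv n).forall_congr fun x => iff_congr h.mem_dual_iff (h x)

theorem isDoublyEven_iff (h : C.HasSupports W) : C.IsDoublyEven ↔ ∀ s ∈ W, 4 ∣ #s :=
  h.forall_mem_iff (p := fun s => 4 ∣ #s)

theorem hasMinWeight_iff (h : C.HasSupports W) {d : ℕ} :
    C.HasMinWeight d ↔ IsLeast {w | ∃ s ∈ W, s.Nonempty ∧ #s = w} d := by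
  simp only [HasMinWeight, ← h.exists_mem_iff, supportEquiv_nonempty,
    hammingNorm_eq_card_supportEquiv]

theorem isExtremalDoublyEvenSelfDual_iff (h : C.HasSupports W) :
    C.IsExtremalDoublyEvenSelfDual ↔ IsDoublyEvenSelfDual W ∧
      IsLeast {w | ∃ s ∈ W, s.Nonempty ∧ #s = w} (4 * (n / 24) + 4) := by
  rw [← h.hasMinWeight_iff]
  exact ⟨fun hC => ⟨⟨h.isSelfDual_iff.1 hC.selfDual, h.isDoublyEven_iff.1 hC.doublyEven⟩,
      hC.minWeight⟩,
    fun ⟨hW, hmin⟩ => ⟨h.isDoublyEven_iff.2 hW.four_dvd_card, h.isSelfDual_iff.2 hW.evenDual_eq,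
      hmin⟩⟩

end HasSupports

theorem exists_hasSupports (C : BinaryCode n) : ∃ W, C.HasSupports W := by
  classical
  exact ⟨({s | (supportEquiv n).symm s ∈ C} : Finset _), fun x => by simp⟩

theorem exists_isExtremalDoublyEvenSelfDual_iff :
    (∃ C : BinaryCode n, C.IsExtremalDoublyEvenSelfDual) ↔
      ∃ W : Finset (Finset (Fin n)), IsDoublyEvenSelfDual W ∧
        IsLeast {w | ∃ s ∈ W, s.Nonempty ∧ #s = w} (4 * (n / 24) + 4) := by
  constructor
  · rintro ⟨C, hC⟩
    obtain ⟨W, h⟩ := C.exists_hasSupports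
    exact ⟨W, h.isExtremalDoublyEvenSelfDual_iff.1 hC⟩
  · rintro ⟨W, hW⟩
    have h : (isLinearFamily_of_evenDual_eq hW.1.evenDual_eq).toBinaryCode.HasSupports W :=
      fun x => Iff.rfl
    exact ⟨_, h.isExtremalDoublyEvenSelfDual_iff.2 hW⟩

end BinaryCode

end Supports

section Main

variable {m k lam : ℕ}

theorem isDesignParameters_of_mem
    (h : (24 * m, k, lam) ∈ ({(72, 24, 1406405), (72, 32, 238957796),
      (96, 36, 28080500448), (96, 44, 1167789832440),
      (120, 56, 5156299310025435), (144, 68, 21788133027489299328)} : Set (ℕ × ℕ × ℕ))) :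
    IsDesignParameters m k lam := by
  simp only [Set.mem_insert_iff, Set.mem_singleton_iff, Prod.mk.injEq] at h
  rcases h with ⟨hm, rfl, rfl⟩ | ⟨hm, rfl, rfl⟩ | ⟨hm, rfl, rfl⟩ | ⟨hm, rfl, rfl⟩ |
    ⟨hm, rfl, rfl⟩ | ⟨hm, rfl, rfl⟩
  · obtain rfl : m = 3 := by lia
    exact .length72_block24
  · obtain rfl : m = 3 := by lia
    exact .length72_block32
  · obtain rfl : m = 4 := by lia
    exact .length96_block36
  · obtain rfl : m = 4 := by lia
    exact .length96_block44
  · obtain rfl : m = 5 := by lia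
    exact .length120_block56
  · obtain rfl : m = 6 := by lia
    exact .length144_block68

theorem isLeast_card_of_isDesign {X : Type*} [Fintype X] [DecidableEq X] {B W : Finset (Finset X)}
    (h : IsDesignParameters m k lam) (hB : IsDesign 5 (24 * m) k lam B)
    (hW : IsDoublyEvenSelfDual W) (hBW : B ⊆ W) :
    IsLeast {w | ∃ s ∈ W, s.Nonempty ∧ #s = w} (4 * m + 4) := by
  have hd := hB.four_mul_lt_card h hW hBW
  obtain ⟨c, hc, hcard⟩ := hW.exists_card_eq_four_mul_add_four h hB.card_points hd
  refine ⟨⟨c, hc, card_pos.1 (by lia), hcard⟩, ?_⟩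
  rintro w ⟨s, hs, hne, rfl⟩
  have h4 := hW.four_dvd_card s hs
  have hlt := hd s hs hne
  lia

end Main

theorem theorem1 (m k lam : ℕ)
    (h : (24 * m, k, lam) ∈ ({(72, 24, 1406405), (72, 32, 238957796),
      (96, 36, 28080500448), (96, 44, 1167789832440),
      (120, 56, 5156299310025435), (144, 68, 21788133027489299328)} : Set (ℕ × ℕ × ℕ))) :
    (∃ B : Finset (Finset (Fin (24 * m))), IsSelfOrthogonalDesign 5 (24 * m) k lam B) ↔
      ∃ C : BinaryCode (24 * m), BinaryCode.IsExtremalDoublyEvenSelfDual C := by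
  have hpar := isDesignParameters_of_mem h
  have hm : 24 * m / 24 = m := Nat.mul_div_cancel_left m (by norm_num)
  rw [BinaryCode.exists_isExtremalDoublyEvenSelfDual_iff, hm]
  constructor
  · rintro ⟨B, hB⟩
    obtain ⟨W, hBW, hW⟩ := hB.exists_isDoublyEvenSelfDual_superset (r := 3 * m) (by ring)
      (mem_middleWeights.1 hpar.blockSize_mem_middleWeights).1
    exact ⟨W, hW, isLeast_card_of_isDesign hpar hB.toIsDesign hW hBW⟩
  · rintro ⟨W, hW, hmin⟩
    have hd : ∀ c ∈ W, c.Nonempty → 4 * m < #c := fun c hc hne => by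
      have hle := hmin.2 ⟨c, hc, hne, rfl⟩
      lia
    exact ⟨{c ∈ W | #c = k}, hW.isSelfOrthogonalDesign hpar (Fintype.card_fin _) hd⟩
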